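/- For real $s>-2$ and $z\in[0,1]$ let $$S_s(z):=\int_0^{\pi/2}\frac{\sin^{s+1}(2\alpha)}{2^{s+1}\,(1-z\sin^2\alpha)^{s/2}}\,\mathrm{d}\alpha .$$ This integral converges, and $$S_s(z)=\int_0^1\frac{t^{s+1}(1-t^2)^{s/2}}{(1-zt^2)^{s/2}}\,\mathrm{d}t =\frac{\Gamma\left(\frac{s+2}{2}\right)^2}{2\,\Gamma(s+2)}\;{}_2F_1\left(\frac{s+2}{2},\frac s2;s+2;z\right),$$ where ${}_2F_1(a,b;c;z)=\sum_{n\ge0}\frac{(a)_n(b)_n}{(c)_n}\frac{z^n}{n!}$ is the Gauss hypergeometric function, $(a)_n=a(a+1)\cdots(a+n-1)$ and $(a)_0=1$. Moreover, for every integer $d\ge2$ and every $\lambda\in[0,1]$, the following integrals converge and $$\int_0^1S_{d-3}\left(\frac{4\lambda r}{(\lambda+r)^2}\right)\frac{(\lambda+r)^{3-d}\,r^{d-1}}{\sqrt{1-r^2}}\,\mathrm{d}r =\frac{\pi^{3/2}\,\Gamma\left(\frac{d-1}{2}\right)}{2^{d+1}\,\Gamma\left(\frac d2\right)}\left(\left(\frac3d-1\right)\lambda^2+1\right)$$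 and, equivalently, $$\int_0^1{}_2F_1\left(\frac{d-1}{2},\frac{d-3}{2};d-1;\frac{4\lambda r}{(\lambda+r)^2}\right)\frac{(\lambda+r)^{3-d}\,r^{d-1}}{\sqrt{1-r^2}}\,\mathrm{d}r =\frac{\pi}{4}\left(\left(\frac3d-1\right)\lambda^2+1\right).$$ -/

import Mathlib

/-- The special function `S_s(z) = ∫₀^{π/2} sin(2α)^{s+1} / (2^{s+1} (1 - z sin²α)^{s/2}) dα`.
It is meant for real `s > -2` and `z ∈ [0, 1]`; both bases of the real powers are then nonnegative
on the interval of integration. -/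
noncomputable def specialS (s z : ℝ) : ℝ :=
  ∫ α in (0 : ℝ)..(Real.pi / 2),
    Real.sin (2 * α) ^ (s + 1) / ((2 : ℝ) ^ (s + 1) * (1 - z * Real.sin α ^ 2) ^ (s / 2))

/-!
The formulas for `specialS` are Euler's integral for `₂F₁`: after `t = sin α` and `u = t ^ 2` the
integrand is a beta weight times `(1 - zu) ^ (-s/2)`, and the binomial series can be integrated term
by term. The interchange holds up to `z = 1` since `s / 2 > -1` makes all terms but the first of one
sign (`hasSum_euler_integral`, `specialS_formulas`).

For the integral formula put `d = n + 2`. Then `(l + r) ^ (3 - d) * specialS (d - 3) z`, with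
`z = 4lr / (l + r) ^ 2`, is up to a constant the mean of the kernel `|x - y| ^ (3 - d)` over the
sphere `|y| = r` in `ℝᵈ`, where `|x| = l` (`specialS_mul_eq_integral`). The claim is therefore that
the potential of the density `(1 - |y|²) ^ (-1/2)` on the unit ball is a quadratic polynomial in
`|x|`. Rotational symmetry reduces this to an integral over a half-plane with weight `y ^ (d - 2)`.
In polar coordinates `(ρ, φ)` about `x` the singular kernel is absorbed by the volume element, which
leaves `ρ ^ 2` against the arcsine weight on the chords through `x`
(`lintegral_ballPotentialIntegrand_Ioi`). Opposite rays form a chord, whose integral is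
`π (m² + h² / 2)` with midpoint at distance `|m| = l |cos φ|` from `x` and half-length `h`,
`h² = 1 - l² sin² φ` (`lintegral_sq_div_sqrt`). What remains is the recurrence for `∫ sin ^ n`.
All this is done with Lebesgue integrals of nonnegative functions, which also yields convergence.
-/

open MeasureTheory Set

/-! ### Euler's integral for the hypergeometric function -/

/-- The binomial series, with its coefficients written as `(b)ₙ / n!`. -/
theorem hasSum_one_sub_rpow_neg (b : ℝ) {x : ℝ} (hx : |x| < 1) :
    HasSum (fun n : ℕ => (n.factorial : ℝ)⁻¹ * (ascPochhammer ℝ n).eval b * x ^ n)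
      ((1 - x) ^ (-b)) := by
  have h := (Real.one_div_one_sub_rpow_hasFPowerSeriesOnBall_zero b).hasSum (y := x)
    (by simpa [enorm_eq_nnnorm, ← NNReal.coe_lt_coe] using hx)
  have h1 : 0 ≤ 1 - x := by linarith [le_abs_self x]
  rw [zero_add, one_div, ← Real.rpow_neg h1] at h
  refine h.congr_fun ?_
  intro n
  rw [FormalMultilinearSeries.ofScalars_apply_eq, ← Ring.multichoose_eq, smul_eq_mul]
  have := Ring.factorial_nsmul_multichoose_eq_ascPochhammer b n
  rw [Polynomial.ascPochhammer_smeval_eq_eval, nsmul_eq_mul] at this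
  rw [← this, inv_mul_cancel_left₀ (by positivity)]

theorem ofReal_beta_integrand {p q u : ℝ} (h0 : 0 ≤ u) (h1 : u ≤ 1) :
    ((u ^ (p - 1) * (1 - u) ^ (q - 1) : ℝ) : ℂ) =
      (u : ℂ) ^ ((p : ℂ) - 1) * (1 - (u : ℂ)) ^ ((q : ℂ) - 1) := by
  rw [Complex.ofReal_mul, Complex.ofReal_cpow h0, Complex.ofReal_cpow (sub_nonneg.2 h1)]
  push_cast
  rfl

theorem integrableOn_beta {p q : ℝ} (hp : 0 < p) (hq : 0 < q) :
    IntegrableOn (fun u : ℝ => u ^ (p - 1) * (1 - u) ^ (q - 1)) (Ioo 0 1) := by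
  have h := Complex.betaIntegral_convergent (u := p) (v := q) (by simpa) (by simpa)
  rw [intervalIntegrable_iff_integrableOn_Ioo_of_le zero_le_one] at h
  refine IntegrableOn.congr_fun (Integrable.re h) (fun u hu => ?_) measurableSet_Ioo
  rw [← ofReal_beta_integrand hu.1.le hu.2.le]
  exact Complex.ofReal_re _

theorem integral_beta {p q : ℝ} (hp : 0 < p) (hq : 0 < q) :
    ∫ u in Ioo (0 : ℝ) 1, u ^ (p - 1) * (1 - u) ^ (q - 1) =
      Real.Gamma p * Real.Gamma q / Real.Gamma (p + q) := by
  have h := ProbabilityTheory.beta_eq_betaIntegralReal p q hp hq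
  rw [ProbabilityTheory.beta] at h
  rw [h, Complex.betaIntegral, intervalIntegral.integral_of_le zero_le_one,
    ← integral_Ioc_eq_integral_Ioo,
    ← setIntegral_congr_fun measurableSet_Ioc fun u hu => ofReal_beta_integrand hu.1.le hu.2,
    integral_complex_ofReal]
  exact (Complex.ofReal_re _).symm

theorem Gamma_add_natCast {x : ℝ} (hx : 0 < x) (n : ℕ) :
    Real.Gamma (x + n) = (ascPochhammer ℝ n).eval x * Real.Gamma x := by
  induction n with
  | zero => simp
  | succ n ih =>
    rw [Nat.cast_succ, ← add_assoc, Real.Gamma_add_one (by positivity), ih, ascPochhammer_succ_eval]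
    ring

theorem integral_beta_mul_pow {p q : ℝ} (hp : 0 < p) (hq : 0 < q) (n : ℕ) :
    ∫ u in Ioo (0 : ℝ) 1, u ^ (p - 1) * (1 - u) ^ (q - 1) * u ^ n =
      Real.Gamma p * Real.Gamma q / Real.Gamma (p + q) *
        ((ascPochhammer ℝ n).eval p * ((ascPochhammer ℝ n).eval (p + q))⁻¹) := by
  have h := integral_beta (p := p + n) (by positivity) hq
  rw [add_right_comm, Gamma_add_natCast hp, Gamma_add_natCast (add_pos hp hq)] at h
  trans ∫ u in Ioo (0 : ℝ) 1, u ^ (p + n - 1) * (1 - u) ^ (q - 1)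
  · refine setIntegral_congr_fun measurableSet_Ioo fun u hu => ?_
    rw [add_sub_right_comm, Real.rpow_add_natCast hu.1.ne']
    ring
  · rw [h, div_eq_mul_inv, div_eq_mul_inv, mul_inv]
    ring

/-- For `b > -1` all the `(b)ₙ` with `n ≥ 1` have the sign of `b`, since `(b)ₙ₊₁ = b (b + 1)ₙ`.
Hence, from the second term on, the binomial series of `(1 - x)⁻ᵇ` has terms of constant sign for
`x ≥ 0`. -/
theorem abs_ascPochhammer_eval_succ {b : ℝ} (hb : -1 < b) (n : ℕ) :
    |(ascPochhammer ℝ (n + 1)).eval b| = SignType.sign b * (ascPochhammer ℝ (n + 1)).eval b := by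
  rw [ascPochhammer_succ_left]
  simp only [Polynomial.eval_mul, Polynomial.eval_X, Polynomial.eval_comp, Polynomial.eval_add,
    Polynomial.eval_one, abs_mul]
  rw [abs_of_pos (ascPochhammer_pos n (b + 1) (by linarith)), ← mul_assoc, sign_mul_self]

/-- Euler's integral for `₂F₁(p, b; p + q; z)`, including the boundary point `z = 1`. The binomial
series of `(1 - zu)⁻ᵇ` is integrated term by term against the beta weight. As its terms after the
first have a constant sign, the series of absolute values sums to a combination of the weight and
of the full integrand, so that integrability of the latter gives the domination. -/
theorem hasSum_euler_integral {p q b z : ℝ} (hp : 0 < p) (hq : 0 < q) (hb : -1 < b) (hz0 : 0 ≤ z)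
    (hz1 : z ≤ 1)
    (hint : IntegrableOn (fun u : ℝ => u ^ (p - 1) * (1 - u) ^ (q - 1) * (1 - z * u) ^ (-b))
      (Ioo 0 1)) :
    HasSum (fun n : ℕ => Real.Gamma p * Real.Gamma q / Real.Gamma (p + q) *
        (((n.factorial : ℝ)⁻¹ * (ascPochhammer ℝ n).eval p * (ascPochhammer ℝ n).eval b *
          ((ascPochhammer ℝ n).eval (p + q))⁻¹) • z ^ n))
      (∫ u in Ioo (0 : ℝ) 1, u ^ (p - 1) * (1 - u) ^ (q - 1) * (1 - z * u) ^ (-b)) := by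
  set w : ℝ → ℝ := fun u => u ^ (p - 1) * (1 - u) ^ (q - 1) with hw
  set f : ℕ → ℝ → ℝ := fun n u =>
    w u * ((n.factorial : ℝ)⁻¹ * (ascPochhammer ℝ n).eval b * (z * u) ^ n)
    with hf
  have hsum : ∀ u ∈ Ioo (0 : ℝ) 1, HasSum (fun n => f n u) (w u * (1 - z * u) ^ (-b)) := by
    intro u hu
    refine (hasSum_one_sub_rpow_neg b ?_).mul_left _
    rw [abs_of_nonneg (mul_nonneg hz0 hu.1.le)]
    nlinarith [hu.1, hu.2]
  have hw0 : ∀ u ∈ Ioo (0 : ℝ) 1, 0 ≤ w u := fun u hu =>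
    mul_nonneg (Real.rpow_nonneg hu.1.le _) (Real.rpow_nonneg (by linarith [hu.2]) _)
  have hnorm : ∀ u ∈ Ioo (0 : ℝ) 1, ∀ n, ‖f (n + 1) u‖ = SignType.sign b * f (n + 1) u := by
    intro u hu n
    simp only [hf, Real.norm_eq_abs, abs_mul, abs_ascPochhammer_eval_succ hb]
    rw [abs_of_nonneg (hw0 u hu), abs_of_nonneg (a := ((n + 1).factorial : ℝ)⁻¹) (by positivity),
      abs_of_nonneg (a := (z * u) ^ (n + 1)) (pow_nonneg (mul_nonneg hz0 hu.1.le) _)]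
    ring
  have hf0 : ∀ u, f 0 u = w u := by simp [hf]
  have hnsum : ∀ u ∈ Ioo (0 : ℝ) 1, HasSum (fun n => ‖f n u‖)
      (SignType.sign b * (w u * (1 - z * u) ^ (-b) - w u) + w u) := by
    intro u hu
    rw [← hasSum_nat_add_iff' 1]
    have h := (hasSum_nat_add_iff' 1).2 (hsum u hu)
    simp only [Finset.sum_range_one, hf0, Real.norm_of_nonneg (hw0 u hu), add_sub_cancel_right]
      at h ⊢
    simp_rw [hnorm u hu]
    exact h.mul_left _
  have hwi := integrableOn_beta hp hq
  have key := hasSum_integral_of_dominated_convergence (μ := volume.restrict (Ioo (0 : ℝ) 1))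
    (F := f) (f := fun u => w u * (1 - z * u) ^ (-b)) (fun n u => ‖f n u‖)
    (fun n => ?_) (fun n => Filter.Eventually.of_forall fun u => le_rfl)
    (ae_restrict_of_forall_mem measurableSet_Ioo fun u hu => (hnsum u hu).summable) ?_
    (ae_restrict_of_forall_mem measurableSet_Ioo hsum)
  · refine key.congr_fun ?_
    intro n
    have : ∀ u, f n u =
        ((n.factorial : ℝ)⁻¹ * (ascPochhammer ℝ n).eval b * z ^ n) * (w u * u ^ n) := by
      intro u; simp only [hf, mul_pow]; ring
    simp_rw [this]
    rw [integral_const_mul, integral_beta_mul_pow hp hq, smul_eq_mul]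
    ring
  · exact hwi.aestronglyMeasurable.mul (by fun_prop)
  · refine (((hint.sub hwi).const_mul (SignType.sign b : ℝ)).add hwi).congr ?_
    exact ae_restrict_of_forall_mem measurableSet_Ioo fun u hu => (hnsum u hu).tsum_eq.symm

/-- The integrand is dominated by `u ^ (s / 2)` if `s ≥ 0`, and by the beta weight if `s ≤ 0`. -/
theorem integrableOn_euler {s z : ℝ} (hs : -2 < s) (hz0 : 0 ≤ z) (hz1 : z ≤ 1) :
    IntegrableOn (fun u : ℝ => u ^ (s / 2) * (1 - u) ^ (s / 2) * (1 - z * u) ^ (-(s / 2)))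
      (Ioo 0 1) := by
  have hm : ∀ S : Set ℝ, AEStronglyMeasurable
      (fun u : ℝ => u ^ (s / 2) * (1 - u) ^ (s / 2) * (1 - z * u) ^ (-(s / 2)))
      (volume.restrict S) := fun S => by
    apply Measurable.aestronglyMeasurable
    fun_prop
  have hle : ∀ u ∈ Ioo (0 : ℝ) 1, z * u ≤ u ∧ 0 ≤ z * u := fun u hu =>
    ⟨mul_le_of_le_one_left hu.1.le hz1, mul_nonneg hz0 hu.1.le⟩
  have hnn : ∀ u ∈ Ioo (0 : ℝ) 1,
      0 ≤ u ^ (s / 2) * (1 - u) ^ (s / 2) * (1 - z * u) ^ (-(s / 2)) := fun u hu => by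
    obtain ⟨h1, h2⟩ := hle u hu
    have := hu.2
    have := hu.1
    exact mul_nonneg (mul_nonneg (Real.rpow_nonneg (by linarith) _)
      (Real.rpow_nonneg (by linarith) _)) (Real.rpow_nonneg (by linarith) _)
  rcases le_total 0 s with h | h
  · have hi : IntegrableOn (fun u : ℝ => u ^ (s / 2)) (Ioo 0 1) := by
      simpa using integrableOn_beta (p := s / 2 + 1) (q := 1) (by linarith) one_pos
    refine Integrable.mono' hi (hm _) (ae_restrict_of_forall_mem measurableSet_Ioo fun u hu => ?_)
    obtain ⟨h1, h2⟩ := hle u hu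
    have h3 := hu.2
    rw [Real.norm_of_nonneg (hnn u hu), mul_assoc, Real.rpow_neg (by linarith), ← div_eq_mul_inv,
      ← Real.div_rpow (by linarith) (by linarith)]
    exact mul_le_of_le_one_right (Real.rpow_nonneg hu.1.le _) (Real.rpow_le_one
      (div_nonneg (by linarith) (by linarith)) (div_le_one_of_le₀ (by linarith) (by linarith))
      (by linarith))
  · have hi := integrableOn_beta (p := s / 2 + 1) (q := s / 2 + 1) (by linarith) (by linarith)
    simp only [add_sub_cancel_right] at hi
    refine Integrable.mono' hi (hm _) (ae_restrict_of_forall_mem measurableSet_Ioo fun u hu => ?_)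
    obtain ⟨h1, h2⟩ := hle u hu
    have h3 := hu.2
    rw [Real.norm_of_nonneg (hnn u hu)]
    exact mul_le_of_le_one_right (mul_nonneg (Real.rpow_nonneg hu.1.le _)
      (Real.rpow_nonneg (by linarith) _)) (Real.rpow_le_one (by linarith) (by linarith)
      (by linarith))

theorem integral_euler {s z : ℝ} (hs : -2 < s) (hz0 : 0 ≤ z) (hz1 : z ≤ 1) :
    ∫ u in Ioo (0 : ℝ) 1, u ^ (s / 2) * (1 - u) ^ (s / 2) * (1 - z * u) ^ (-(s / 2)) =
      Real.Gamma ((s + 2) / 2) ^ 2 / Real.Gamma (s + 2) *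
        ₂F₁ ((s + 2) / 2) (s / 2) (s + 2) z := by
  have hp : 0 < (s + 2) / 2 := by linarith
  have e : (s + 2) / 2 - 1 = s / 2 := by ring
  have h := hasSum_euler_integral (b := s / 2) hp hp (by linarith) hz0 hz1
    (by simpa only [e] using integrableOn_euler hs hz0 hz1)
  rw [e, add_halves] at h
  rw [← h.tsum_eq, tsum_mul_left, ordinaryHypergeometric_eq_tsum, sq]

/-! ### The three expressions of `specialS` -/

theorem setIntegral_comp_sin (f : ℝ → ℝ) :
    (IntegrableOn f (Ioo 0 1) ↔
      IntegrableOn (fun a => Real.cos a * f (Real.sin a)) (Ioo 0 (Real.pi / 2))) ∧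
    ∫ t in Ioo (0 : ℝ) 1, f t = ∫ a in Ioo (0 : ℝ) (Real.pi / 2), Real.cos a * f (Real.sin a) := by
  have him : Real.sin '' Ioo 0 (Real.pi / 2) = Ioo 0 1 := by
    ext t
    constructor
    · rintro ⟨a, ha, rfl⟩
      refine ⟨Real.sin_pos_of_pos_of_lt_pi ha.1 (by linarith [ha.2, Real.pi_pos]), ?_⟩
      simpa using Real.sin_lt_sin_of_lt_of_le_pi_div_two (by linarith [ha.1, Real.pi_pos])
        le_rfl ha.2
    · intro ht
      exact ⟨Real.arcsin t, ⟨Real.arcsin_pos.2 ht.1, Real.arcsin_lt_pi_div_two.2 ht.2⟩,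
        Real.sin_arcsin (by linarith [ht.1]) ht.2.le⟩
  have hinj : InjOn Real.sin (Ioo 0 (Real.pi / 2)) := Real.injOn_sin.mono fun (a : ℝ) ha =>
    mem_Icc.2 ⟨by linarith [ha.1, Real.pi_pos], ha.2.le⟩
  have hd : ∀ a ∈ Ioo 0 (Real.pi / 2),
      HasDerivWithinAt Real.sin (Real.cos a) (Ioo 0 (Real.pi / 2)) a :=
    fun a _ => (Real.hasDerivAt_sin a).hasDerivWithinAt
  have hc : ∀ a ∈ Ioo 0 (Real.pi / 2),
      |Real.cos a| • f (Real.sin a) = Real.cos a * f (Real.sin a) :=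
    fun a ha => by
      rw [abs_of_nonneg (Real.cos_nonneg_of_mem_Icc ⟨by linarith [ha.1, Real.pi_pos], ha.2.le⟩),
        smul_eq_mul]
  rw [← him, integrableOn_image_iff_integrableOn_abs_deriv_smul measurableSet_Ioo hd hinj,
    integral_image_eq_integral_abs_deriv_smul measurableSet_Ioo hd hinj]
  exact ⟨integrableOn_congr_fun hc measurableSet_Ioo, setIntegral_congr_fun measurableSet_Ioo hc⟩

theorem setIntegral_comp_sq (f : ℝ → ℝ) :
    (IntegrableOn f (Ioo 0 1) ↔ IntegrableOn (fun t => 2 * t * f (t ^ 2)) (Ioo 0 1)) ∧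
    ∫ u in Ioo (0 : ℝ) 1, f u = ∫ t in Ioo (0 : ℝ) 1, 2 * t * f (t ^ 2) := by
  have him : (fun t : ℝ => t ^ 2) '' Ioo 0 1 = Ioo 0 1 := by
    ext u
    constructor
    · rintro ⟨t, ht, rfl⟩
      exact ⟨pow_pos ht.1 2, pow_lt_one₀ ht.1.le ht.2 two_ne_zero⟩
    · intro hu
      exact ⟨√u, ⟨Real.sqrt_pos.2 hu.1, by simpa using Real.sqrt_lt_sqrt hu.1.le hu.2⟩,
        Real.sq_sqrt hu.1.le⟩
  have hinj : InjOn (fun t : ℝ => t ^ 2) (Ioo 0 1) := fun a ha b hb h =>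
    (pow_left_inj₀ ha.1.le hb.1.le two_ne_zero).1 h
  have hd : ∀ t ∈ Ioo (0 : ℝ) 1, HasDerivWithinAt (fun t : ℝ => t ^ 2) (2 * t) (Ioo 0 1) t :=
    fun t _ => by simpa using (hasDerivAt_pow 2 t).hasDerivWithinAt
  have hc : ∀ t ∈ Ioo (0 : ℝ) 1, |2 * t| • f (t ^ 2) = 2 * t * f (t ^ 2) := fun t ht => by
    rw [abs_of_pos (by linarith [ht.1]), smul_eq_mul]
  have h1 := integrableOn_image_iff_integrableOn_abs_deriv_smul measurableSet_Ioo hd hinj f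
  have h2 := integral_image_eq_integral_abs_deriv_smul measurableSet_Ioo hd hinj f
  rw [him] at h1 h2
  rw [h1, h2]
  exact ⟨integrableOn_congr_fun hc measurableSet_Ioo, setIntegral_congr_fun measurableSet_Ioo hc⟩

/-- The substitutions `t = sin α` and `u = t ^ 2` turn `specialS` into Euler's integral. Both are
used in the form that transports integrability as well. -/
theorem specialS_formulas {s z : ℝ} (hs : -2 < s) (hz0 : 0 ≤ z) (hz1 : z ≤ 1) :
      IntervalIntegrable
        (fun α : ℝ => Real.sin (2 * α) ^ (s + 1) /
          ((2 : ℝ) ^ (s + 1) * (1 - z * Real.sin α ^ 2) ^ (s / 2)))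
        MeasureTheory.volume 0 (Real.pi / 2) ∧
      IntervalIntegrable
        (fun t : ℝ => t ^ (s + 1) * (1 - t ^ 2) ^ (s / 2) / (1 - z * t ^ 2) ^ (s / 2))
        MeasureTheory.volume 0 1 ∧
      specialS s z =
        ∫ t in (0 : ℝ)..1, t ^ (s + 1) * (1 - t ^ 2) ^ (s / 2) / (1 - z * t ^ 2) ^ (s / 2) ∧
      specialS s z =
        Real.Gamma ((s + 2) / 2) ^ 2 / (2 * Real.Gamma (s + 2)) *
          ₂F₁ ((s + 2) / 2) (s / 2) (s + 2) z := by
  obtain ⟨hi1, he1⟩ := setIntegral_comp_sq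
    (fun u : ℝ => u ^ (s / 2) * (1 - u) ^ (s / 2) * (1 - z * u) ^ (-(s / 2)))
  have hi := hi1.1 (integrableOn_euler hs hz0 hz1)
  have hE := he1.symm.trans (integral_euler hs hz0 hz1)
  have hz : ∀ t ∈ Ioo (0 : ℝ) 1, 0 < 1 - z * t ^ 2 := fun t ht => by
    have : t ^ 2 < 1 := pow_lt_one₀ ht.1.le ht.2 two_ne_zero
    have : 0 < t ^ 2 := pow_pos ht.1 2
    nlinarith
  have hT : ∀ t ∈ Ioo (0 : ℝ) 1,
      2 * t * ((t ^ 2) ^ (s / 2) * (1 - t ^ 2) ^ (s / 2) * (1 - z * t ^ 2) ^ (-(s / 2))) =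
      2 * (t ^ (s + 1) * (1 - t ^ 2) ^ (s / 2) / (1 - z * t ^ 2) ^ (s / 2)) := fun t ht => by
    rw [Real.rpow_neg (hz t ht).le, ← Real.rpow_natCast t 2, ← Real.rpow_mul ht.1.le,
      Real.rpow_add_one ht.1.ne', show ((2 : ℕ) : ℝ) * (s / 2) = s by push_cast; ring]
    ring
  rw [integrableOn_congr_fun hT measurableSet_Ioo] at hi
  rw [setIntegral_congr_fun measurableSet_Ioo hT, integral_const_mul] at hE
  have hi2 : IntegrableOn
      (fun t : ℝ => t ^ (s + 1) * (1 - t ^ 2) ^ (s / 2) / (1 - z * t ^ 2) ^ (s / 2)) (Ioo 0 1) := by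
    simpa [IntegrableOn] using hi.const_mul (1 / 2)
  obtain ⟨hi3, he3⟩ := setIntegral_comp_sin
    (fun t : ℝ => t ^ (s + 1) * (1 - t ^ 2) ^ (s / 2) / (1 - z * t ^ 2) ^ (s / 2))
  have hA : ∀ a ∈ Ioo 0 (Real.pi / 2), Real.cos a * (Real.sin a ^ (s + 1) *
      (1 - Real.sin a ^ 2) ^ (s / 2) / (1 - z * Real.sin a ^ 2) ^ (s / 2)) =
      Real.sin (2 * a) ^ (s + 1) / ((2 : ℝ) ^ (s + 1) * (1 - z * Real.sin a ^ 2) ^ (s / 2)) := by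
    intro a ha
    have hc : 0 < Real.cos a := Real.cos_pos_of_mem_Ioo ⟨by linarith [ha.1, Real.pi_pos], ha.2⟩
    have hsn : 0 < Real.sin a :=
      Real.sin_pos_of_pos_of_lt_pi ha.1 (by linarith [ha.2, Real.pi_pos])
    have h2 : (2 : ℝ) ^ (s + 1) ≠ 0 := by positivity
    rw [Real.sin_two_mul, Real.mul_rpow (by positivity) hc.le, Real.mul_rpow (by positivity) hsn.le,
      mul_assoc, mul_div_mul_left _ _ h2, ← Real.cos_sq', ← Real.rpow_natCast (Real.cos a) 2,
      ← Real.rpow_mul hc.le, show ((2 : ℕ) : ℝ) * (s / 2) = s by push_cast; ring,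
      Real.rpow_add_one hc.ne']
    ring
  rw [integrableOn_congr_fun hA measurableSet_Ioo] at hi3
  rw [setIntegral_congr_fun measurableSet_Ioo hA] at he3
  have hpi : (0 : ℝ) ≤ Real.pi / 2 := by positivity
  have hS : specialS s z =
      ∫ t in (0 : ℝ)..1, t ^ (s + 1) * (1 - t ^ 2) ^ (s / 2) / (1 - z * t ^ 2) ^ (s / 2) := by
    rw [specialS, intervalIntegral.integral_of_le hpi, intervalIntegral.integral_of_le zero_le_one,
      integral_Ioc_eq_integral_Ioo, integral_Ioc_eq_integral_Ioo, he3]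
  refine ⟨(intervalIntegrable_iff_integrableOn_Ioo_of_le hpi).2 (hi3.1 hi2),
    (intervalIntegrable_iff_integrableOn_Ioo_of_le zero_le_one).2 hi2, hS, ?_⟩
  rw [hS, intervalIntegral.integral_of_le zero_le_one, integral_Ioc_eq_integral_Ioo]
  linear_combination hE / 2

/-! ### Polar coordinates and integrals over chords -/

theorem lintegral_upperHalfPlane_polar {f : ℝ × ℝ → ENNReal} (hf : Measurable f) :
    ∫⁻ p in {p : ℝ × ℝ | 0 < p.2}, f p =
      ∫⁻ θ in Ioo 0 Real.pi, ∫⁻ r in Ioi (0 : ℝ),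
        ENNReal.ofReal r * f (r * Real.cos θ, r * Real.sin θ) := by
  have hS : MeasurableSet {p : ℝ × ℝ | 0 < p.2} := measurableSet_lt measurable_const measurable_snd
  have hT : MeasurableSet (Ioi (0 : ℝ) ×ˢ Ioo 0 Real.pi) := measurableSet_Ioi.prod measurableSet_Ioo
  have hsub : Ioi (0 : ℝ) ×ˢ Ioo 0 Real.pi ⊆ polarCoord.target := by
    rintro ⟨r, θ⟩ ⟨hr, hθ⟩
    exact ⟨hr, by linarith [hθ.1, Real.pi_pos], hθ.2⟩
  rw [← lintegral_indicator hS, ← lintegral_comp_polarCoord_symm]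
  have h : ∀ p ∈ polarCoord.target, ENNReal.ofReal p.1 •
      ({p : ℝ × ℝ | 0 < p.2}.indicator f) (polarCoord.symm p) =
      (Ioi (0 : ℝ) ×ˢ Ioo 0 Real.pi).indicator (fun p => ENNReal.ofReal p.1 *
        f (p.1 * Real.cos p.2, p.1 * Real.sin p.2)) p := by
    rintro ⟨r, θ⟩ ⟨hr, hθ⟩
    simp only [mem_Ioi, mem_Ioo] at hr hθ
    by_cases h0 : 0 < θ
    · have : 0 < r * Real.sin θ := mul_pos hr (Real.sin_pos_of_pos_of_lt_pi h0 hθ.2)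
      simp [polarCoord_symm_apply, indicator, this, hr, h0, hθ.2]
    · have : ¬ 0 < r * Real.sin θ := not_lt.2 (mul_nonpos_of_nonneg_of_nonpos hr.le
        (Real.sin_nonpos_of_nonpos_of_neg_pi_le (not_lt.1 h0) hθ.1.le))
      simp [polarCoord_symm_apply, indicator, this, h0]
  rw [setLIntegral_congr_fun polarCoord.open_target.measurableSet h, setLIntegral_indicator hT,
    inter_eq_left.2 hsub, Measure.volume_eq_prod, ← Measure.prod_restrict,
    lintegral_prod_symm _ (by fun_prop)]

/-- The second moment, about a point at signed distance `m` from its midpoint, of the arcsine weight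
on a chord of half-length `h`. Outside the chord the square root is `0`, and the integrand vanishes
because division by zero gives `0`. -/
theorem lintegral_sq_div_sqrt (m : ℝ) {h : ℝ} (hh : 0 < h) :
    ∫⁻ x : ℝ, ENNReal.ofReal (x ^ 2 / √(h ^ 2 - (x - m) ^ 2)) =
      ENNReal.ofReal (Real.pi * (m ^ 2 + h ^ 2 / 2)) := by
  have hpos : ∀ u ∈ Ioo (-h) h, 0 < h ^ 2 - u ^ 2 := fun u hu => by nlinarith [hu.1, hu.2]
  set F : ℝ → ℝ := fun u =>
    (m ^ 2 + h ^ 2 / 2) * Real.arcsin (u / h) - (2 * m + u / 2) * √(h ^ 2 - u ^ 2) with hF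
  have hcont : Continuous F := by fun_prop
  have hderiv : ∀ u ∈ Ioo (-h) h, HasDerivAt F ((u + m) ^ 2 / √(h ^ 2 - u ^ 2)) u := by
    intro u hu
    have hp := hpos u hu
    have hs : 0 < √(h ^ 2 - u ^ 2) := Real.sqrt_pos.2 hp
    have h1 : HasDerivAt (fun u : ℝ => Real.arcsin (u / h)) (1 / √(h ^ 2 - u ^ 2)) u := by
      have := (Real.hasDerivAt_arcsin (x := u / h)
        (by rw [ne_eq, div_eq_iff hh.ne']; linarith [hu.1])
        (by rw [ne_eq, div_eq_iff hh.ne']; linarith [hu.2])).comp u ((hasDerivAt_id u).div_const h)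
      refine this.congr_deriv ?_
      rw [show (1 : ℝ) - (u / h) ^ 2 = (h ^ 2 - u ^ 2) / h ^ 2 by field_simp,
        Real.sqrt_div hp.le, Real.sqrt_sq hh.le]
      field_simp
    have h2 : HasDerivAt (fun u : ℝ => √(h ^ 2 - u ^ 2)) (-u / √(h ^ 2 - u ^ 2)) u := by
      have := ((hasDerivAt_pow 2 u).const_sub (h ^ 2)).sqrt hp.ne'
      refine this.congr_deriv ?_
      field_simp
      norm_num [mul_comm]
    have h3 : HasDerivAt (fun u : ℝ => 2 * m + u / 2) (1 / 2) u :=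
      ((hasDerivAt_id u).div_const 2).const_add _
    refine ((h1.const_mul (m ^ 2 + h ^ 2 / 2)).sub (h3.mul h2)).congr_deriv ?_
    field_simp
    rw [Real.sq_sqrt hp.le]
    ring
  have hnn : ∀ u, 0 ≤ (u + m) ^ 2 / √(h ^ 2 - u ^ 2) := fun u => by positivity
  have hint := intervalIntegral.integrableOn_deriv_of_nonneg hcont.continuousOn hderiv
    fun u _ => hnn u
  have hval := intervalIntegral.integral_eq_sub_of_hasDerivAt_of_le (by linarith)
    hcont.continuousOn hderiv ((intervalIntegrable_iff_integrableOn_Ioc_of_le (by linarith)).2 hint)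
  rw [intervalIntegral.integral_of_le (by linarith)] at hval
  calc ∫⁻ x : ℝ, ENNReal.ofReal (x ^ 2 / √(h ^ 2 - (x - m) ^ 2))
      = ∫⁻ x : ℝ, (fun u => ENNReal.ofReal ((u + m) ^ 2 / √(h ^ 2 - u ^ 2))) (x - m) := by
        simp
    _ = ∫⁻ u : ℝ, ENNReal.ofReal ((u + m) ^ 2 / √(h ^ 2 - u ^ 2)) :=
        lintegral_sub_right_eq_self (μ := volume)
          (fun u => ENNReal.ofReal ((u + m) ^ 2 / √(h ^ 2 - u ^ 2))) m
    _ = ∫⁻ u in Ioc (-h) h, ENNReal.ofReal ((u + m) ^ 2 / √(h ^ 2 - u ^ 2)) := by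
        refine (setLIntegral_eq_of_support_subset ?_).symm
        intro u hu
        by_contra hn
        apply hu
        have : h ^ 2 - u ^ 2 ≤ 0 := by
          by_contra! hlt
          have := abs_lt_of_sq_lt_sq' (by linarith : u ^ 2 < h ^ 2) hh.le
          exact hn ⟨this.1, this.2.le⟩
        simp [Real.sqrt_eq_zero_of_nonpos this]
    _ = ENNReal.ofReal (F h - F (-h)) := by
        rw [← hval, ofReal_integral_eq_lintegral_ofReal hint
          (Filter.Eventually.of_forall fun u => hnn u)]
    _ = _ := by
        simp only [hF, div_self hh.ne', neg_div, Real.arcsin_neg, Real.arcsin_one, neg_sq,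
          sub_self, Real.sqrt_zero]
        congr 1
        ring

theorem lintegral_Ioi_add_lintegral_Ioi_neg {f : ℝ → ENNReal} :
    (∫⁻ x in Ioi (0 : ℝ), f x) + ∫⁻ x in Ioi (0 : ℝ), f (-x) = ∫⁻ x, f x := by
  rw [← lintegral_add_compl (μ := volume) f (measurableSet_Ioi (a := (0 : ℝ))), compl_Ioi,
    setLIntegral_congr (Iio_ae_eq_Iic (a := (0 : ℝ)) (μ := volume)).symm]
  congr 1
  rw [← (Measure.measurePreserving_neg (volume : Measure ℝ)).setLIntegral_comp_preimage_emb
    (MeasurableEquiv.neg ℝ).measurableEmbedding f (Iio 0)]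
  simp

theorem setLIntegral_Ioo_comp_sub (a : ℝ) (f : ℝ → ENNReal) :
    ∫⁻ x in Ioo 0 a, f (a - x) = ∫⁻ x in Ioo 0 a, f x := by
  rw [← (Measure.measurePreserving_sub_left (volume : Measure ℝ) a).setLIntegral_comp_preimage_emb
    (MeasurableEquiv.subLeft a).measurableEmbedding f (Ioo 0 a)]
  simp

theorem integral_sin_pow_mul_chord (n : ℕ) (l : ℝ) :
    ∫ φ in Ioo 0 Real.pi, Real.sin φ ^ n * (Real.pi *
        ((l * Real.cos φ) ^ 2 + (1 - (l * Real.sin φ) ^ 2) / 2)) =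
      Real.pi / 2 * ((3 / ((n + 2 : ℕ) : ℝ) - 1) * l ^ 2 + 1) *
        ∫ φ in (0)..Real.pi, Real.sin φ ^ n := by
  have h := integral_sin_pow (a := 0) (b := Real.pi) n
  simp only [Real.sin_zero, Real.sin_pi, ne_eq, Nat.add_eq_zero_iff, one_ne_zero, and_false,
    not_false_eq_true, zero_pow, zero_mul, sub_self, zero_div, zero_add] at h
  rw [← integral_Ioc_eq_integral_Ioo, ← intervalIntegral.integral_of_le Real.pi_pos.le]
  have : ∀ φ : ℝ, Real.sin φ ^ n * (Real.pi *
        ((l * Real.cos φ) ^ 2 + (1 - (l * Real.sin φ) ^ 2) / 2)) =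
      (Real.pi * (l ^ 2 + 1 / 2)) * Real.sin φ ^ n -
        (Real.pi * (3 / 2 * l ^ 2)) * Real.sin φ ^ (n + 2) := fun φ => by
    rw [mul_pow, Real.cos_sq']; ring
  simp_rw [this]
  rw [intervalIntegral.integral_sub (Continuous.intervalIntegrable (by fun_prop) _ _)
    (Continuous.intervalIntegrable (by fun_prop) _ _), intervalIntegral.integral_const_mul,
    intervalIntegral.integral_const_mul, h]
  push_cast
  field_simp
  ring

/-- The potential in polar coordinates about the point where it is evaluated. The two rays with
angles `φ` and `π - φ` contribute together the integral over a full line, because the reflection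
`(φ, x) ↦ (π - φ, -x)` preserves the integrand. -/
theorem lintegral_polar_chords (n : ℕ) {l : ℝ} (hl0 : 0 ≤ l) (hl1 : l ≤ 1) :
    ∫⁻ φ in Ioo 0 Real.pi, ENNReal.ofReal (Real.sin φ ^ n) * ∫⁻ x in Ioi (0 : ℝ),
      ENNReal.ofReal (x ^ 2 / √((1 - (l * Real.sin φ) ^ 2) - (x - l * Real.cos φ) ^ 2)) =
    ENNReal.ofReal (Real.pi / 4 * ((3 / ((n + 2 : ℕ) : ℝ) - 1) * l ^ 2 + 1) *
        ∫ φ in (0)..Real.pi, Real.sin φ ^ n) := by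
  set f : ℝ → ℝ → ENNReal := fun φ x => ENNReal.ofReal (x ^ 2 /
    √((1 - (l * Real.sin φ) ^ 2) - (x - l * Real.cos φ) ^ 2)) with hf
  set g : ℝ → ENNReal := fun φ =>
    ENNReal.ofReal (Real.sin φ ^ n) * ∫⁻ x in Ioi (0 : ℝ), f φ x with hg
  have hmeas : Measurable g := by
    refine Measurable.mul (by fun_prop) ?_
    refine Measurable.lintegral_prod_right' (f := fun p : ℝ × ℝ => f p.1 p.2) ?_
    simp only [hf]
    fun_prop
  have hsum : ∀ φ, g φ + g (Real.pi - φ) =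
      ENNReal.ofReal (Real.sin φ ^ n) * ∫⁻ x, f φ x := by
    intro φ
    rw [← lintegral_Ioi_add_lintegral_Ioi_neg, mul_add]
    simp only [hg, hf, Real.sin_pi_sub, Real.cos_pi_sub, neg_sq]
    congr 5 with x
    congr 4
    ring
  have htwo : 2 * ∫⁻ φ in Ioo 0 Real.pi, g φ = ENNReal.ofReal (Real.pi / 2 *
      ((3 / ((n + 2 : ℕ) : ℝ) - 1) * l ^ 2 + 1) * ∫ φ in (0)..Real.pi, Real.sin φ ^ n) := by
    have hae : ∀ᵐ φ, φ ∈ Ioo 0 Real.pi → ENNReal.ofReal (Real.sin φ ^ n) * ∫⁻ x, f φ x =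
        ENNReal.ofReal (Real.sin φ ^ n * (Real.pi *
        ((l * Real.cos φ) ^ 2 + (1 - (l * Real.sin φ) ^ 2) / 2))) := by
      -- for `l = 1` the chord degenerates to a point at `φ = π / 2`
      filter_upwards [compl_mem_ae_iff.2 (measure_singleton (Real.pi / 2))] with φ hne hφ
      have hs := Real.sin_pos_of_pos_of_lt_pi hφ.1 hφ.2
      have hc : Real.cos φ ≠ 0 := by
        rcases lt_or_gt_of_ne hne with h | h
        · exact (Real.cos_pos_of_mem_Ioo ⟨by linarith [hφ.1, Real.pi_pos], h⟩).ne'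
        · exact (Real.cos_neg_of_pi_div_two_lt_of_lt h (by linarith [hφ.2, Real.pi_pos])).ne
      have hpos : 0 < 1 - (l * Real.sin φ) ^ 2 := by
        have h1 : 0 < Real.cos φ ^ 2 := by positivity
        have h2 : l ^ 2 ≤ 1 := pow_le_one₀ hl0 hl1
        rw [mul_pow]
        nlinarith [Real.sin_sq_add_cos_sq φ, sq_nonneg (Real.sin φ)]
      have h := lintegral_sq_div_sqrt (l * Real.cos φ) (Real.sqrt_pos.2 hpos)
      rw [Real.sq_sqrt hpos.le] at h
      rw [ENNReal.ofReal_mul (by positivity), ← h]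
    have hnn : ∀ φ ∈ Ioo 0 Real.pi, 0 ≤ Real.sin φ ^ n * (Real.pi *
        ((l * Real.cos φ) ^ 2 + (1 - (l * Real.sin φ) ^ 2) / 2)) := by
      intro φ hφ
      have hs := Real.sin_pos_of_pos_of_lt_pi hφ.1 hφ.2
      have : l * Real.sin φ ≤ 1 := mul_le_one₀ hl1 hs.le (Real.sin_le_one φ)
      have : (l * Real.sin φ) ^ 2 ≤ 1 := pow_le_one₀ (by positivity) this
      have : 0 ≤ 1 - (l * Real.sin φ) ^ 2 := by linarith
      positivity
    calc 2 * ∫⁻ φ in Ioo 0 Real.pi, g φ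
        = (∫⁻ φ in Ioo 0 Real.pi, g φ) + ∫⁻ φ in Ioo 0 Real.pi, g (Real.pi - φ) := by
          rw [setLIntegral_Ioo_comp_sub, two_mul]
      _ = ∫⁻ φ in Ioo 0 Real.pi, ENNReal.ofReal (Real.sin φ ^ n * (Real.pi *
            ((l * Real.cos φ) ^ 2 + (1 - (l * Real.sin φ) ^ 2) / 2))) := by
          rw [← lintegral_add_left hmeas]
          simp_rw [hsum]
          exact setLIntegral_congr_fun_ae measurableSet_Ioo hae
      _ = _ := by
          rw [← integral_sin_pow_mul_chord, ofReal_integral_eq_lintegral_ofReal]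
          · exact (Continuous.integrableOn_Icc (by fun_prop)).mono_set Ioo_subset_Icc_self
          · exact ae_restrict_of_forall_mem measurableSet_Ioo hnn
  rw [← ENNReal.mul_right_inj two_ne_zero ENNReal.ofNat_ne_top, htwo,
    show (2 : ENNReal) = ENNReal.ofReal 2 by simp, ← ENNReal.ofReal_mul zero_le_two]
  congr 1
  ring

/-! ### The potential of the arcsine density on the unit ball -/

theorem lintegral_translate_upperHalfPlane {f : ℝ × ℝ → ENNReal} (l : ℝ) :
    ∫⁻ p in {p : ℝ × ℝ | 0 < p.2}, f (p.1 - l, p.2) = ∫⁻ p in {p : ℝ × ℝ | 0 < p.2}, f p := by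
  rw [← (measurePreserving_sub_right (volume : Measure (ℝ × ℝ))
      (l, 0)).setLIntegral_comp_preimage_emb
    (MeasurableEquiv.subRight (l, (0 : ℝ))).measurableEmbedding f]
  simp [Prod.sub_def]

/-- The potential of the weight `(1 - |y|²) ^ (-1/2)` on the unit ball of `ℝⁿ⁺²` for the kernel
`|x - y| ^ (1 - n)` at a point `x` with `|x| = l`, written in the polar coordinates `p = (θ, r)` of
a half-plane bounded by the axis through `x`, without the volume of the `n`-sphere of directions.
The angle is measured from the direction opposite to `x`, so that the squared distance is
`l² + r² + 2lr cos θ`. For `r ≥ 1` the value is `0`, as the square root vanishes. -/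
noncomputable def ballPotentialIntegrand (n : ℕ) (l : ℝ) (p : ℝ × ℝ) : ℝ :=
  Real.sin p.1 ^ n * (l ^ 2 + p.2 ^ 2 + 2 * l * p.2 * Real.cos p.1) ^ ((1 - (n : ℝ)) / 2) *
    (p.2 ^ (n + 1) / √(1 - p.2 ^ 2))

theorem measurable_ballPotentialIntegrand (n : ℕ) (l : ℝ) :
    Measurable (ballPotentialIntegrand n l) := by
  unfold ballPotentialIntegrand
  fun_prop

theorem ballPotentialIntegrand_nonneg (n : ℕ) {l θ r : ℝ}
    (hθ : θ ∈ Ioo 0 Real.pi) (hr : 0 < r) : 0 ≤ ballPotentialIntegrand n l (θ, r) := by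
  have hs := Real.sin_pos_of_pos_of_lt_pi hθ.1 hθ.2
  have h : l ^ 2 + r ^ 2 + 2 * l * r * Real.cos θ =
      (l + r * Real.cos θ) ^ 2 + (r * Real.sin θ) ^ 2 := by
    linear_combination (-r ^ 2) * Real.sin_sq_add_cos_sq θ
  simp only [ballPotentialIntegrand, h]
  positivity

/-- The integral over the half-disc is moved by the translation `l` along the axis and written in
polar coordinates again: about the new centre the kernel, the weight `y ^ n` and the area element
combine to `ρ ^ 2 sin ^ n φ`. -/
theorem lintegral_ballPotentialIntegrand_Ioi (n : ℕ) {l : ℝ} (hl0 : 0 ≤ l) (hl1 : l ≤ 1) :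
    ∫⁻ θ in Ioo 0 Real.pi, ∫⁻ r in Ioi (0 : ℝ),
        ENNReal.ofReal (ballPotentialIntegrand n l (θ, r)) =
      ENNReal.ofReal (Real.pi / 4 * ((3 / ((n + 2 : ℕ) : ℝ) - 1) * l ^ 2 + 1) *
        ∫ φ in (0)..Real.pi, Real.sin φ ^ n) := by
  set f : ℝ × ℝ → ENNReal := fun p => ENNReal.ofReal (p.2 ^ n *
    ((p.1 + l) ^ 2 + p.2 ^ 2) ^ ((1 - (n : ℝ)) / 2) / √(1 - p.1 ^ 2 - p.2 ^ 2)) with hf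
  have hfm : Measurable f := by fun_prop
  have hfm' : Measurable fun p : ℝ × ℝ => f (p.1 - l, p.2) := by fun_prop
  have h := lintegral_translate_upperHalfPlane (f := f) l
  rw [lintegral_upperHalfPlane_polar hfm, lintegral_upperHalfPlane_polar hfm'] at h
  trans ∫⁻ θ in Ioo 0 Real.pi, ∫⁻ r in Ioi (0 : ℝ),
        ENNReal.ofReal r * f (r * Real.cos θ, r * Real.sin θ)
  · refine setLIntegral_congr_fun measurableSet_Ioo fun θ hθ =>
      setLIntegral_congr_fun measurableSet_Ioi fun r (hr : 0 < r) => ?_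
    have hsc := Real.sin_sq_add_cos_sq θ
    simp only [hf, ballPotentialIntegrand]
    rw [← ENNReal.ofReal_mul hr.le,
      show (r * Real.cos θ + l) ^ 2 + (r * Real.sin θ) ^ 2 =
        l ^ 2 + r ^ 2 + 2 * l * r * Real.cos θ by linear_combination r ^ 2 * hsc,
      show 1 - (r * Real.cos θ) ^ 2 - (r * Real.sin θ) ^ 2 = 1 - r ^ 2 by
        linear_combination -r ^ 2 * hsc]
    congr 1
    ring
  · rw [← h, ← lintegral_polar_chords n hl0 hl1]
    refine setLIntegral_congr_fun measurableSet_Ioo fun θ hθ => ?_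
    simp only
    rw [← lintegral_const_mul _ (by fun_prop)]
    refine setLIntegral_congr_fun measurableSet_Ioi fun r (hr : 0 < r) => ?_
    have hsc := Real.sin_sq_add_cos_sq θ
    have hs := Real.sin_pos_of_pos_of_lt_pi hθ.1 hθ.2
    simp only [hf, sub_add_cancel]
    rw [← ENNReal.ofReal_mul hr.le, ← ENNReal.ofReal_mul (by positivity),
      show (r * Real.cos θ) ^ 2 + (r * Real.sin θ) ^ 2 = r ^ 2 by linear_combination r ^ 2 * hsc,
      show 1 - (r * Real.cos θ - l) ^ 2 - (r * Real.sin θ) ^ 2 =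
        1 - (l * Real.sin θ) ^ 2 - (r - l * Real.cos θ) ^ 2 by
        linear_combination (l ^ 2 - r ^ 2) * hsc]
    -- the powers of `r` coming from the weight, the kernel and the area element combine to `r ^ 2`
    have hr2 : r * r ^ n * (r ^ 2) ^ ((1 - (n : ℝ)) / 2) = r ^ 2 := by
      rw [← pow_succ', ← Real.rpow_natCast, ← Real.rpow_natCast, ← Real.rpow_mul hr.le,
        ← Real.rpow_add hr]
      congr 1
      push_cast
      ring
    congr 1
    linear_combination (Real.sin θ ^ n /
      √(1 - (l * Real.sin θ) ^ 2 - (r - l * Real.cos θ) ^ 2)) * hr2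

theorem ballPotentialIntegrand_of_one_le (n : ℕ) (l θ : ℝ) {r : ℝ} (hr : 1 ≤ r) :
    ballPotentialIntegrand n l (θ, r) = 0 := by
  have : 1 - r ^ 2 ≤ 0 := by nlinarith
  simp [ballPotentialIntegrand, Real.sqrt_eq_zero_of_nonpos this]

theorem lintegral_ballPotentialIntegrand (n : ℕ) {l : ℝ} (hl0 : 0 ≤ l) (hl1 : l ≤ 1) :
    ∫⁻ p, ENNReal.ofReal (ballPotentialIntegrand n l p)
        ∂(volume.restrict (Ioo 0 Real.pi)).prod (volume.restrict (Ioo 0 1)) =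
      ENNReal.ofReal (Real.pi / 4 * ((3 / ((n + 2 : ℕ) : ℝ) - 1) * l ^ 2 + 1) *
        ∫ φ in (0)..Real.pi, Real.sin φ ^ n) := by
  have hm := (measurable_ballPotentialIntegrand n l).ennreal_ofReal
  rw [lintegral_prod _ hm.aemeasurable, ← lintegral_ballPotentialIntegrand_Ioi n hl0 hl1]
  refine lintegral_congr fun θ => ?_
  rw [← lintegral_indicator measurableSet_Ioo, ← lintegral_indicator measurableSet_Ioi]
  congr 1 with r
  by_cases h0 : 0 < r
  · by_cases h1 : r < 1
    · simp [indicator, h0, h1]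
    · simp [indicator, h1, ballPotentialIntegrand_of_one_le n l θ (not_lt.1 h1)]
  · simp [indicator, h0]

theorem integrable_ballPotentialIntegrand (n : ℕ) {l : ℝ} (hl0 : 0 ≤ l) (hl1 : l ≤ 1) :
    Integrable (ballPotentialIntegrand n l)
      ((volume.restrict (Ioo 0 Real.pi)).prod (volume.restrict (Ioo 0 1))) ∧
    ∫ p, ballPotentialIntegrand n l p
        ∂(volume.restrict (Ioo 0 Real.pi)).prod (volume.restrict (Ioo 0 1)) =
      Real.pi / 4 * ((3 / ((n + 2 : ℕ) : ℝ) - 1) * l ^ 2 + 1) *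
        ∫ φ in (0)..Real.pi, Real.sin φ ^ n := by
  have hm := (measurable_ballPotentialIntegrand n l)
  have hnn : 0 ≤ᵐ[(volume.restrict (Ioo 0 Real.pi)).prod (volume.restrict (Ioo 0 1))]
      ballPotentialIntegrand n l := by
    rw [Measure.prod_restrict]
    exact ae_restrict_of_forall_mem (measurableSet_Ioo.prod measurableSet_Ioo)
      fun p hp => ballPotentialIntegrand_nonneg n hp.1 hp.2.1
  have hval := lintegral_ballPotentialIntegrand n hl0 hl1
  refine ⟨⟨hm.aestronglyMeasurable, ?_⟩, ?_⟩
  · rw [hasFiniteIntegral_iff_ofReal hnn, hval]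
    exact ENNReal.ofReal_lt_top
  · rw [integral_eq_lintegral_of_nonneg_ae hnn hm.aestronglyMeasurable, hval,
      ENNReal.toReal_ofReal]
    have h1 : 0 < ∫ φ in (0)..Real.pi, Real.sin φ ^ n := integral_sin_pow_pos n
    have h2 : 0 ≤ (3 / ((n + 2 : ℕ) : ℝ) - 1) * l ^ 2 + 1 := by
      have h3 : 0 ≤ 3 / ((n + 2 : ℕ) : ℝ) := by positivity
      have h4 : l ^ 2 ≤ 1 := pow_le_one₀ hl0 hl1
      nlinarith [sq_nonneg l]
    have := Real.pi_pos
    positivity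

/-- With `θ = 2α` one has `(l + r)² (1 - z sin² α) = l² + r² + 2lr cos θ` for
`z = 4lr / (l + r)²`, so that `specialS` is the average of the kernel over a sphere. -/
theorem specialS_mul_eq_integral (n : ℕ) {l r : ℝ} (hl : 0 ≤ l) (hr : 0 < r) :
    specialS ((n : ℝ) - 1) (4 * l * r / (l + r) ^ 2) *
      ((l + r) ^ (1 - (n : ℝ)) * r ^ (n + 1) / √(1 - r ^ 2)) =
    (1 / 2) ^ (n + 1) * ∫ θ in Ioo 0 Real.pi, ballPotentialIntegrand n l (θ, r) := by
  have hlr : 0 < l + r := by linarith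
  set k : ℝ → ℝ := fun θ => (1 / 2) ^ n * ballPotentialIntegrand n l (θ, r) with hk
  have h2 : ∫ θ in Ioo 0 Real.pi, k θ = 2 * ∫ α in (0)..(Real.pi / 2), k (2 * α) := by
    rw [intervalIntegral.mul_integral_comp_mul_left, mul_zero, mul_div_cancel₀ _ two_ne_zero,
      intervalIntegral.integral_of_le Real.pi_pos.le, integral_Ioc_eq_integral_Ioo]
  have h3 : (1 / 2) ^ (n + 1) * ∫ θ in Ioo 0 Real.pi, ballPotentialIntegrand n l (θ, r) =
      ∫ α in (0)..(Real.pi / 2), k (2 * α) := by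
    rw [pow_succ, mul_right_comm, ← integral_const_mul, h2]
    ring
  rw [h3, specialS, ← intervalIntegral.integral_mul_const]
  congr 1 with α
  set X := l ^ 2 + r ^ 2 + 2 * l * r * Real.cos (2 * α) with hX
  have hX0 : 0 ≤ X := by
    have h1 := Real.neg_one_le_cos (2 * α)
    nlinarith [mul_nonneg (mul_nonneg hl hr.le) (by linarith : 0 ≤ 1 + Real.cos (2 * α)),
      sq_nonneg (l - r)]
  have hbase : 1 - 4 * l * r / (l + r) ^ 2 * Real.sin α ^ 2 = X / (l + r) ^ 2 := by
    rw [hX, Real.cos_two_mul, Real.cos_sq']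
    field_simp
    ring
  have hden : ((l + r) ^ 2) ^ (((n : ℝ) - 1) / 2) = ((l + r) ^ (1 - (n : ℝ)))⁻¹ := by
    rw [← Real.rpow_neg hlr.le, ← Real.rpow_natCast, ← Real.rpow_mul hlr.le]
    congr 1
    push_cast
    ring
  simp only [hk, ballPotentialIntegrand, ← hX]
  rw [hbase, sub_add_cancel, Real.rpow_natCast, Real.rpow_natCast,
    Real.div_rpow hX0 (by positivity), hden, show (1 - (n : ℝ)) / 2 = -(((n : ℝ) - 1) / 2) by ring,
    Real.rpow_neg hX0]
  have : (l + r) ^ (1 - (n : ℝ)) ≠ 0 := (Real.rpow_pos_of_pos hlr _).ne'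
  rw [div_inv_eq_mul, one_div_pow]
  field_simp

theorem specialS_zero (n : ℕ) : specialS ((n : ℝ) - 1) 0 =
    (1 / 2) ^ (n + 1) * ∫ φ in (0)..Real.pi, Real.sin φ ^ n := by
  have h := intervalIntegral.mul_integral_comp_mul_left (a := 0) (b := Real.pi / 2)
    (f := fun φ => Real.sin φ ^ n) (c := 2)
  rw [mul_zero, mul_div_cancel₀ _ two_ne_zero] at h
  simp only [specialS, sub_add_cancel, Real.rpow_natCast, zero_mul, sub_zero, Real.one_rpow,
    mul_one, intervalIntegral.integral_div, ← h]
  rw [one_div_pow, pow_succ]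
  field_simp

/-- The normalizing constants agree by Legendre's duplication formula. -/
theorem Gamma_sq_div_two_mul_Gamma (n : ℕ) :
    Real.Gamma (((n : ℝ) + 1) / 2) ^ 2 / (2 * Real.Gamma ((n : ℝ) + 1)) * (Real.pi / 4) =
      Real.pi ^ ((3 : ℝ) / 2) * Real.Gamma (((n : ℝ) + 1) / 2) /
        ((2 : ℝ) ^ (n + 3) * Real.Gamma (((n : ℝ) + 2) / 2)) := by
  have h := Real.Gamma_mul_Gamma_add_half (((n : ℝ) + 1) / 2)
  rw [mul_div_cancel₀ _ two_ne_zero, show ((n : ℝ) + 1) / 2 + 1 / 2 = (n + 2) / 2 by ring,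
    show (1 : ℝ) - (n + 1) = -(n : ℝ) by ring, Real.rpow_neg zero_le_two, Real.rpow_natCast] at h
  have h1 : Real.Gamma (((n : ℝ) + 1) / 2) ≠ 0 := (Real.Gamma_pos_of_pos (by positivity)).ne'
  have h2 : Real.Gamma ((n : ℝ) + 1) ≠ 0 := (Real.Gamma_pos_of_pos (by positivity)).ne'
  have h3 : Real.Gamma (((n : ℝ) + 2) / 2) ≠ 0 := (Real.Gamma_pos_of_pos (by positivity)).ne'
  have h4 : Real.pi ^ ((3 : ℝ) / 2) = Real.pi * √Real.pi := by
    rw [Real.sqrt_eq_rpow, ← Real.rpow_one_add' Real.pi_pos.le (by norm_num)]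
    norm_num
  rw [h4, pow_add]
  field_simp at h ⊢
  linear_combination 4 * h

/-- The constant is expressed through `specialS (n - 1) 0`, which is a multiple of
`∫ sin ^ n`; its evaluation by Gamma functions is not needed here. -/
theorem integral_specialS (n : ℕ) {l : ℝ} (hl0 : 0 ≤ l) (hl1 : l ≤ 1) :
    IntegrableOn (fun r : ℝ => specialS ((n : ℝ) - 1) (4 * l * r / (l + r) ^ 2) *
      ((l + r) ^ (1 - (n : ℝ)) * r ^ (n + 1) / √(1 - r ^ 2))) (Ioo 0 1) ∧
    ∫ r in Ioo (0 : ℝ) 1, specialS ((n : ℝ) - 1) (4 * l * r / (l + r) ^ 2) *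
      ((l + r) ^ (1 - (n : ℝ)) * r ^ (n + 1) / √(1 - r ^ 2)) =
      specialS ((n : ℝ) - 1) 0 * (Real.pi / 4 * ((3 / ((n + 2 : ℕ) : ℝ) - 1) * l ^ 2 + 1)) := by
  obtain ⟨hi, hv⟩ := integrable_ballPotentialIntegrand n hl0 hl1
  have hc : ∀ r ∈ Ioo (0 : ℝ) 1, _ := fun r hr => specialS_mul_eq_integral n hl0 hr.1
  rw [integrableOn_congr_fun hc measurableSet_Ioo, setIntegral_congr_fun measurableSet_Ioo hc,
    integral_const_mul, ← integral_prod_symm _ hi, hv, specialS_zero]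
  exact ⟨hi.integral_prod_right.const_mul _, by ring⟩

/-! ### The integral formulas -/

theorem four_mul_div_add_sq_mem_Icc {l r : ℝ} (hl : 0 ≤ l) (hr : 0 ≤ r) :
    4 * l * r / (l + r) ^ 2 ∈ Icc (0 : ℝ) 1 :=
  ⟨by positivity, div_le_one_of_le₀ (by nlinarith [sq_nonneg (l - r)]) (by positivity)⟩

theorem specialS_eq_const_mul (n : ℕ) {z : ℝ} (hz : z ∈ Icc (0 : ℝ) 1) :
    specialS ((n : ℝ) - 1) z = specialS ((n : ℝ) - 1) 0 *
      ₂F₁ (((n : ℝ) + 1) / 2) (((n : ℝ) - 1) / 2) ((n : ℝ) + 1) z := by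
  have hs : -2 < (n : ℝ) - 1 := by linarith [n.cast_nonneg (α := ℝ)]
  rw [(specialS_formulas hs hz.1 hz.2).2.2.2, (specialS_formulas hs le_rfl zero_le_one).2.2.2,
    ordinaryHypergeometric_zero, mul_one, show (n : ℝ) - 1 + 2 = n + 1 by ring]

theorem specialS_zero_mul (n : ℕ) : specialS ((n : ℝ) - 1) 0 * (Real.pi / 4) =
    Real.pi ^ ((3 : ℝ) / 2) * Real.Gamma (((n : ℝ) + 1) / 2) /
      ((2 : ℝ) ^ (n + 3) * Real.Gamma (((n : ℝ) + 2) / 2)) := by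
  have hs : -2 < (n : ℝ) - 1 := by linarith [n.cast_nonneg (α := ℝ)]
  rw [(specialS_formulas hs le_rfl zero_le_one).2.2.2, ordinaryHypergeometric_zero, mul_one,
    show (n : ℝ) - 1 + 2 = n + 1 by ring, Gamma_sq_div_two_mul_Gamma]

theorem integral_hypergeometric (n : ℕ) {l : ℝ} (hl0 : 0 ≤ l) (hl1 : l ≤ 1) :
    IntegrableOn (fun r : ℝ =>
      ₂F₁ (((n : ℝ) + 1) / 2) (((n : ℝ) - 1) / 2) ((n : ℝ) + 1) (4 * l * r / (l + r) ^ 2) *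
      ((l + r) ^ (1 - (n : ℝ)) * r ^ (n + 1) / √(1 - r ^ 2))) (Ioo 0 1) ∧
    ∫ r in Ioo (0 : ℝ) 1,
      ₂F₁ (((n : ℝ) + 1) / 2) (((n : ℝ) - 1) / 2) ((n : ℝ) + 1) (4 * l * r / (l + r) ^ 2) *
      ((l + r) ^ (1 - (n : ℝ)) * r ^ (n + 1) / √(1 - r ^ 2)) =
      Real.pi / 4 * ((3 / ((n + 2 : ℕ) : ℝ) - 1) * l ^ 2 + 1) := by
  have hC : specialS ((n : ℝ) - 1) 0 ≠ 0 := by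
    have := integral_sin_pow_pos n
    rw [specialS_zero]
    positivity
  have hc : ∀ r ∈ Ioo (0 : ℝ) 1, _ = _ := fun r hr => congrArg
    (· * ((l + r) ^ (1 - (n : ℝ)) * r ^ (n + 1) / √(1 - r ^ 2)))
    (specialS_eq_const_mul n (four_mul_div_add_sq_mem_Icc hl0 hr.1.le))
  obtain ⟨hi, hv⟩ := integral_specialS n hl0 hl1
  rw [integrableOn_congr_fun hc measurableSet_Ioo] at hi
  rw [setIntegral_congr_fun measurableSet_Ioo hc] at hv
  simp only [mul_assoc (specialS ((n : ℝ) - 1) 0)] at hi hv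
  rw [integral_const_mul] at hv
  exact ⟨(integrable_const_mul_iff hC.isUnit _).1 hi, mul_left_cancel₀ hC hv⟩

theorem corollary1p6 :
    -- the three expressions of `S_s(z)`, with convergence of the two integrals
    (∀ s z : ℝ, -2 < s → 0 ≤ z → z ≤ 1 →
      IntervalIntegrable
        (fun α : ℝ => Real.sin (2 * α) ^ (s + 1) /
          ((2 : ℝ) ^ (s + 1) * (1 - z * Real.sin α ^ 2) ^ (s / 2)))
        MeasureTheory.volume 0 (Real.pi / 2) ∧
      IntervalIntegrable
        (fun t : ℝ => t ^ (s + 1) * (1 - t ^ 2) ^ (s / 2) / (1 - z * t ^ 2) ^ (s / 2))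
        MeasureTheory.volume 0 1 ∧
      specialS s z =
        ∫ t in (0 : ℝ)..1, t ^ (s + 1) * (1 - t ^ 2) ^ (s / 2) / (1 - z * t ^ 2) ^ (s / 2) ∧
      specialS s z =
        Real.Gamma ((s + 2) / 2) ^ 2 / (2 * Real.Gamma (s + 2)) *
          ₂F₁ ((s + 2) / 2) (s / 2) (s + 2) z) ∧
    -- the integral formula in terms of `S_{d-3}`
    (∀ (d : ℕ) (l : ℝ), 2 ≤ d → 0 ≤ l → l ≤ 1 →
      IntervalIntegrable
        (fun r : ℝ => specialS ((d : ℝ) - 3) (4 * l * r / (l + r) ^ 2) *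
          ((l + r) ^ (3 - (d : ℝ)) * r ^ ((d : ℝ) - 1) / Real.sqrt (1 - r ^ 2)))
        MeasureTheory.volume 0 1 ∧
      ∫ r in (0 : ℝ)..1, specialS ((d : ℝ) - 3) (4 * l * r / (l + r) ^ 2) *
          ((l + r) ^ (3 - (d : ℝ)) * r ^ ((d : ℝ) - 1) / Real.sqrt (1 - r ^ 2)) =
        Real.pi ^ ((3 : ℝ) / 2) * Real.Gamma (((d : ℝ) - 1) / 2) /
            ((2 : ℝ) ^ (d + 1) * Real.Gamma ((d : ℝ) / 2)) *
          ((3 / (d : ℝ) - 1) * l ^ 2 + 1)) ∧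
    -- the integral formula in terms of the hypergeometric function
    (∀ (d : ℕ) (l : ℝ), 2 ≤ d → 0 ≤ l → l ≤ 1 →
      IntervalIntegrable
        (fun r : ℝ =>
          ₂F₁ (((d : ℝ) - 1) / 2) (((d : ℝ) - 3) / 2) ((d : ℝ) - 1) (4 * l * r / (l + r) ^ 2) *
          ((l + r) ^ (3 - (d : ℝ)) * r ^ ((d : ℝ) - 1) / Real.sqrt (1 - r ^ 2)))
        MeasureTheory.volume 0 1 ∧
      ∫ r in (0 : ℝ)..1,
          ₂F₁ (((d : ℝ) - 1) / 2) (((d : ℝ) - 3) / 2) ((d : ℝ) - 1) (4 * l * r / (l + r) ^ 2) *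
          ((l + r) ^ (3 - (d : ℝ)) * r ^ ((d : ℝ) - 1) / Real.sqrt (1 - r ^ 2)) =
        Real.pi / 4 * ((3 / (d : ℝ) - 1) * l ^ 2 + 1)) := by
  refine ⟨fun s z hs hz0 hz1 => specialS_formulas hs hz0 hz1, fun d l hd hl0 hl1 => ?_,
    fun d l hd hl0 hl1 => ?_⟩ <;> obtain ⟨n, rfl⟩ := Nat.exists_eq_add_of_le' hd <;>
    rw [intervalIntegrable_iff_integrableOn_Ioo_of_le zero_le_one,
      intervalIntegral.integral_of_le zero_le_one, integral_Ioc_eq_integral_Ioo] <;>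
    have e1 : ((n + 2 : ℕ) : ℝ) - 3 = n - 1 := by push_cast; ring
  all_goals
    have e2 : 3 - ((n + 2 : ℕ) : ℝ) = 1 - n := by push_cast; ring
    have e3 : ((n + 2 : ℕ) : ℝ) - 1 = n + 1 := by push_cast; ring
    have e4 : ∀ r : ℝ, r ^ ((n : ℝ) + 1) = r ^ (n + 1) := fun r => by
      rw [← Nat.cast_succ, Real.rpow_natCast]
    simp only [e1, e2, e3, e4]
  · obtain ⟨hi, hv⟩ := integral_specialS n hl0 hl1
    refine ⟨hi, hv.trans ?_⟩
    rw [← mul_assoc, specialS_zero_mul]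
    push_cast
    rfl
  · exact integral_hypergeometric n hl0 hl1
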